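/- Let $(n_l)_{l\ge 1}$ be a sequence of positive integers such that every positive integer divides some partial product $n_1 n_2\cdots n_L$, so that $\mathcal Q=\bigotimes_{l=1}^\infty M_{n_l}$ is the universal UHF algebra. Let $\rho_l:\mathbb Z/n_l\mathbb Z\to U(M_{n_l})$ be the natural representation by cyclic permutation matrices, $\rho_l(s)e_j=e_{j+s}$. Let $G$ be an abelian group, let $i:G\hookrightarrow\prod_{l=1}^\infty\mathbb Z/n_l\mathbb Z$ be an injective homomorphism, and let $\alpha$ be the action of $G$ on $\mathcal Q$ given by $\alpha_g=\bigotimes_{l=1}^\infty \mathrm{Ad}\,\rho_l(i(g)_l)$. An automorphism $\beta$ of $\mathcal Q$ is called *uniformly outer* if for every $a\in\mathcal Q$, every non-zero projection $p\in\mathcal Q$ and every $\varepsilon>0$ there are $k>0$ and mutually orthogonal projections $p_1,\dots,p_k$ with $p=p_1+\cdots+p_k$ and $\|p_j\,a\,\beta(p_j)\|<\varepsilon$ for $1\le j\le k$. For $1\le k<\infty$, $\beta$ has the *order $k$ Rokhlin property* if for every $\varepsilon>0$ and every finite set $F\subset\mathcal Q$ there are mutually orthogonal projections $p_1,\dots,p_k$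 with $p_1+\cdots+p_k=1$ such that, for $1\le j\le k$, $\|p_ja-ap_j\|<\varepsilon$ for all $a\in F$ and $\|\beta(p_j)-p_{j+1}\|<\varepsilon$, where $p_{k+1}=p_1$; $\beta$ has the *order $\infty$ Rokhlin property* if $\beta^j$ is uniformly outer for every $j\ge1$. The action $\alpha$ has the *Rokhlin property* if, for every $g\in G$, $\alpha_g$ has the order $k(g)$ Rokhlin property, where $k(g)\in\{1,2,\dots,\infty\}$ is the order of $g$ in $G$. Then $\alpha$ has the Rokhlin property if and only if $i(G)\cap\bigoplus_{l=1}^\infty\mathbb Z/n_l\mathbb Z=0$. -/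

import Mathlib

noncomputable section

namespace UHFModel

/-! ### Uniform outerness and the Rokhlin property -/

section Rokhlin

variable {A : Type*} [CStarAlgebra A]

/-- An automorphism `α` of a unital C*-algebra is uniformly outer if, for every element `a`, every
non-zero projection `p` and every `ε > 0`, the projection `p` is a sum of finitely many mutually
orthogonal projections `q i` with `‖q i * a * α (q i)‖ < ε`. -/
def IsUniformlyOuter (α : A ≃⋆ₐ[ℂ] A) : Prop :=
  ∀ a p : A, IsStarProjection p → p ≠ 0 → ∀ ε : ℝ, 0 < ε →
    ∃ k : ℕ, 0 < k ∧ ∃ q : Fin k → A,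
      (∀ i, IsStarProjection (q i)) ∧
      (∀ i j, i ≠ j → q i * q j = 0) ∧
      p = ∑ i, q i ∧
      ∀ i, ‖q i * a * α (q i)‖ < ε

/-- The order `k` Rokhlin property of an automorphism, `1 ≤ k < ∞`; the index `i + 1` is taken
cyclically (`finRotate k` sends `i` to `i + 1` and the last index to the first one). -/
def HasFiniteOrderRokhlin (k : ℕ) (α : A ≃⋆ₐ[ℂ] A) : Prop :=
  ∀ ε : ℝ, 0 < ε → ∀ F : Finset A, ∃ p : Fin k → A,
    (∀ i, IsStarProjection (p i)) ∧
    (∀ i j, i ≠ j → p i * p j = 0) ∧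
    (∀ i, ∀ a ∈ F, ‖p i * a - a * p i‖ < ε) ∧
    (∀ i, ‖α (p i) - p (finRotate k i)‖ < ε) ∧
    ∑ i, p i = 1

/-- The order `∞` Rokhlin property of an automorphism: all its positive powers are uniformly
outer. -/
def HasInfiniteOrderRokhlin (α : A ≃⋆ₐ[ℂ] A) : Prop :=
  ∀ j : ℕ, 1 ≤ j → IsUniformlyOuter (α ^ j)

/-- An action of an (additively written) abelian group has the Rokhlin property if every `g` acts
with the order `k` Rokhlin property, where `k` is the order of `g` in the group.
(`addOrderOf g = 0` encodes that `g` has infinite order.) -/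
def HasRokhlinProperty {G : Type*} [AddCommGroup G]
    (α : Multiplicative G →* (A ≃⋆ₐ[ℂ] A)) : Prop :=
  ∀ g : G,
    (0 < addOrderOf g → HasFiniteOrderRokhlin (addOrderOf g) (α (Multiplicative.ofAdd g))) ∧
    (addOrderOf g = 0 → HasInfiniteOrderRokhlin (α (Multiplicative.ofAdd g)))

end Rokhlin

/-! ### The product and the direct sum of the cyclic groups -/

/-- The full product `∏ₗ ℤ/nₗℤ`. -/
abbrev CyclicProd (n : ℕ → ℕ) : Type := ∀ l, ZMod (n l)

/-- The direct sum `⨁ₗ ℤ/nₗℤ` as a subgroup of the product. -/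
def cyclicSum (n : ℕ → ℕ) : AddSubgroup (CyclicProd n) where
  carrier := {x | {l | x l ≠ 0}.Finite}
  zero_mem' := by simp
  add_mem' {x y} hx hy := by
    refine (Set.Finite.union hx hy).subset fun l hl => ?_
    by_contra h
    simp only [Set.mem_union, Set.mem_ofPred_eq, not_or, not_not] at h
    exact hl (by simp [h.1, h.2])
  neg_mem' {x} hx := by simpa using hx

/-- The supernatural number `∏ₗ nₗ` is the universal one: each positive integer divides a finite
partial product. This is what it means for `⨂ₗ M_{nₗ}` to be the universal UHF algebra. -/
def IsUniversalType (n : ℕ → ℕ) : Prop :=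
  ∀ k : ℕ, 0 < k → ∃ L : ℕ, k ∣ ∏ l ∈ Finset.range L, n l

/-! ### Operators on `ℓ²(∏ₗ ℤ/nₗℤ)` -/

/-- The Hilbert space `ℓ²(X)` of the underlying set `X` of `∏ₗ ℤ/nₗℤ`. -/
abbrev Hilb (n : ℕ → ℕ) : Type := lp (fun _ : CyclicProd n => ℂ) 2

section Operators

variable {n : ℕ → ℕ}

theorem memlp_comp_perm (e : Equiv.Perm (CyclicProd n)) (ξ : Hilb n) :
    Memℓp (fun x => ξ (e x)) 2 := by
  have h := lp.memℓp ξ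
  rw [memℓp_gen_iff (by simp)] at h ⊢
  exact (e.summable_iff (f := fun x => ‖ξ x‖ ^ (2 : ENNReal).toReal)).2 h

/-- The permutation unitary: `(permIso e ξ) x = ξ (e⁻¹ x)`, that is, `δ_x ↦ δ_{e x}`. -/
def permIso (e : Equiv.Perm (CyclicProd n)) : Hilb n ≃ₗᵢ[ℂ] Hilb n where
  toFun ξ := ⟨fun x => ξ (e.symm x), memlp_comp_perm e.symm ξ⟩
  invFun ξ := ⟨fun x => ξ (e x), memlp_comp_perm e ξ⟩
  map_add' _ _ := rfl
  map_smul' _ _ := rfl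
  left_inv ξ := by ext x; simp
  right_inv ξ := by ext x; simp
  norm_map' ξ := by
    rw [lp.norm_eq_tsum_rpow (by simp), lp.norm_eq_tsum_rpow (by simp)]
    congr 1
    exact e.symm.tsum_eq (fun x => ‖ξ x‖ ^ (2 : ENNReal).toReal)

@[simp]
theorem permIso_apply (e : Equiv.Perm (CyclicProd n)) (ξ : Hilb n) (x : CyclicProd n) :
    permIso e ξ x = ξ (e.symm x) := rfl

/-- The unitary of `B(ℓ²(X))` given by translation, `δ_x ↦ δ_{x + g}`. -/
def translation (n : ℕ → ℕ) :
    Multiplicative (CyclicProd n) →* unitary (Hilb n →L[ℂ] Hilb n) where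
  toFun g := Unitary.linearIsometryEquiv.symm (permIso (Equiv.addRight g.toAdd))
  map_one' := by
    rw [MulEquiv.map_eq_one_iff]
    ext ξ x
    change ξ (x + -0) = ξ x
    simp
  map_mul' g h := by
    rw [← map_mul]
    congr 1
    ext ξ x
    change ξ (x + -(g.toAdd + h.toAdd)) = ξ (x + -g.toAdd + -h.toAdd)
    rw [neg_add, add_assoc]

@[simp]
theorem translation_apply (g : CyclicProd n) (ξ : Hilb n) (x : CyclicProd n) :
    (translation n (Multiplicative.ofAdd g) : Hilb n →L[ℂ] Hilb n) ξ x = ξ (x - g) := by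
  simp [translation, sub_eq_add_neg]

@[simp]
theorem star_translation_apply (g : CyclicProd n) (ξ : Hilb n) (x : CyclicProd n) :
    (star (translation n (Multiplicative.ofAdd g) : Hilb n →L[ℂ] Hilb n)) ξ x = ξ (x + g) := by
  have h : star (translation n (Multiplicative.ofAdd g) : Hilb n →L[ℂ] Hilb n)
      = (translation n (Multiplicative.ofAdd (-g)) : Hilb n →L[ℂ] Hilb n) := by
    rw [ofAdd_neg, map_inv, ← Unitary.star_eq_inv, Unitary.coe_star]
  rw [h, translation_apply, sub_neg_eq_add]

variable [∀ l, NeZero (n l)]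

/-- Multiplication by a function that depends on the `l`-th coordinate only. -/
def diagOp (l : ℕ) (f : ZMod (n l) → ℂ) : Hilb n →L[ℂ] Hilb n :=
  have bd : ∀ (ξ : Hilb n) (x : CyclicProd n), ‖f (x l) * ξ x‖ ≤ ‖((‖f‖ : ℂ) • ξ) x‖ := by
    intro ξ x
    simp only [lp.coeFn_smul, Pi.smul_apply, smul_eq_mul, norm_mul, Complex.norm_real, norm_norm]
    exact mul_le_mul_of_nonneg_right (norm_le_pi_norm f (x l)) (norm_nonneg _)
  LinearMap.mkContinuous
    { toFun := fun ξ =>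
        ⟨fun x => f (x l) * ξ x, Memℓp.mono' (lp.memℓp ((‖f‖ : ℂ) • ξ)) (bd ξ)⟩
      map_add' := fun ξ η => by ext x; exact mul_add _ _ _
      map_smul' := fun c ξ => by ext x; exact mul_left_comm _ _ _ }
    ‖f‖ fun ξ => by
      refine (lp.norm_mono (by simp) (bd ξ)).trans ?_
      rw [norm_smul]
      simp

@[simp]
theorem diagOp_apply (l : ℕ) (f : ZMod (n l) → ℂ) (ξ : Hilb n) (x : CyclicProd n) :
    diagOp l f ξ x = f (x l) * ξ x := rfl

/-- The operator by which a matrix `a ∈ M_{nₗ}` acts on `ℓ²(X)` through the `l`-th coordinate;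
see `factorOp_apply` for the formula. -/
def factorOp (l : ℕ) (a : Matrix (ZMod (n l)) (ZMod (n l)) ℂ) : Hilb n →L[ℂ] Hilb n :=
  ∑ s : ZMod (n l), diagOp l (fun i => a i (i + s)) *
    (translation n (Multiplicative.ofAdd (-Pi.single l s)) : Hilb n →L[ℂ] Hilb n)

theorem factorOp_apply (l : ℕ) (a : Matrix (ZMod (n l)) (ZMod (n l)) ℂ) (ξ : Hilb n)
    (x : CyclicProd n) :
    factorOp l a ξ x = ∑ j, a (x l) j * ξ (Function.update x l j) := by
  have h1 : factorOp l a ξ x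
      = ∑ s, a (x l) (x l + s) * ξ (x + Pi.single l s) := by
    simp only [factorOp, sum_apply, lp.coeFn_sum, Finset.sum_apply,
      mul_apply_eq_comp, diagOp_apply, translation_apply, sub_neg_eq_add]
  rw [h1, ← Equiv.sum_comp (Equiv.addLeft (x l))
    (fun j => a (x l) j * ξ (Function.update x l j))]
  refine Finset.sum_congr rfl fun s _ => ?_
  have h2 : x + Pi.single l s = Function.update x l (x l + s) := by
    ext m
    by_cases h : m = l
    · subst h; simp
    · simp [h]
  rw [h2]
  rfl

theorem factorOp_star (l : ℕ) (a : Matrix (ZMod (n l)) (ZMod (n l)) ℂ) :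
    factorOp (n := n) l (star a) = star (factorOp l a) := by
  classical
  refine lp.ext_continuousLinearMap (by simp) fun y => ?_
  ext x
  simp only [ContinuousLinearMap.comp_apply, lp.singleContinuousLinearMap_apply]
  have h1 : (star (factorOp l a) (lp.single 2 y (1 : ℂ)) : Hilb n) x
      = star ((factorOp l a (lp.single 2 x (1 : ℂ)) : Hilb n) y) := by
    have e1 := lp.inner_single_left (𝕜 := ℂ) x (1 : ℂ)
      (star (factorOp l a) (lp.single 2 y (1 : ℂ)) : Hilb n)
    have e2 := lp.inner_single_right (𝕜 := ℂ) y (1 : ℂ)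
      (factorOp l a (lp.single 2 x (1 : ℂ)) : Hilb n)
    rw [ContinuousLinearMap.star_eq_adjoint] at e1 ⊢
    rw [ContinuousLinearMap.adjoint_inner_right, e2] at e1
    simpa using e1.symm
  rw [h1, factorOp_apply, factorOp_apply, star_sum]
  have key : ∀ u v : CyclicProd n, ∀ j : ZMod (n l),
      (lp.single 2 u (1 : ℂ) : Hilb n) (Function.update v l j)
        = if j = u l ∧ Function.update v l (u l) = u then 1 else 0 := by
    intro u v j
    rw [lp.single_apply]
    by_cases h : Function.update v l j = u
    · have hj : j = u l := by rw [← h]; simp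
      subst hj
      simp [h]
    · rw [if_neg]
      · simp [h]
      · rintro ⟨rfl, h'⟩
        exact h h'
  have sym : (Function.update x l (y l) = y) ↔ (Function.update y l (x l) = x) := by
    constructor <;> intro h
    · rw [← h]; simp
    · rw [← h]; simp
  by_cases h : Function.update x l (y l) = y
  · have h' := sym.1 h
    simp only [key, h, h', Matrix.star_apply]
    simp [apply_ite (starRingEnd ℂ)]
  · have h' : ¬ Function.update y l (x l) = x := fun q => h (sym.2 q)
    simp only [key, h, h']
    simp

/-- The `l`-th tensor factor `M_{nₗ}`, as a unital *-homomorphism into `B(ℓ²(X))`. -/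
def factorHom (n : ℕ → ℕ) [∀ l, NeZero (n l)] (l : ℕ) :
    Matrix (ZMod (n l)) (ZMod (n l)) ℂ →⋆ₐ[ℂ] (Hilb n →L[ℂ] Hilb n) where
  toFun := factorOp l
  map_one' := by
    ext ξ x
    simp [factorOp_apply, Matrix.one_apply]
  map_mul' a b := by
    ext ξ x
    simp only [mul_apply_eq_comp, factorOp_apply, Function.update_self,
      Function.update_idem, Matrix.mul_apply, Finset.sum_mul, Finset.mul_sum]
    rw [Finset.sum_comm]
    simp only [mul_assoc]
  map_zero' := by
    ext ξ x
    simp [factorOp_apply]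
  map_add' a b := by
    ext ξ x
    simp [factorOp_apply, add_mul, Finset.sum_add_distrib]
  commutes' c := by
    ext ξ x
    simp [factorOp_apply, Algebra.algebraMap_eq_smul_one, Matrix.one_apply]
  map_star' := factorOp_star l

theorem factorHom_apply (l : ℕ) (a : Matrix (ZMod (n l)) (ZMod (n l)) ℂ) (ξ : Hilb n)
    (x : CyclicProd n) :
    factorHom n l a ξ x = ∑ j, a (x l) j * ξ (Function.update x l j) :=
  factorOp_apply l a ξ x

/-- Different tensor factors commute. -/
theorem factorHom_commute {l m : ℕ} (h : l ≠ m) (a : Matrix (ZMod (n l)) (ZMod (n l)) ℂ)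
    (b : Matrix (ZMod (n m)) (ZMod (n m)) ℂ) :
    Commute (factorHom n l a) (factorHom n m b) := by
  ext ξ x
  simp only [mul_apply_eq_comp, factorHom_apply, Finset.mul_sum,
    Function.update_of_ne h, Function.update_of_ne h.symm]
  rw [Finset.sum_comm]
  refine Finset.sum_congr rfl fun j _ => Finset.sum_congr rfl fun k _ => ?_
  rw [Function.update_comm h, mul_left_comm]

end Operators

/-! ### The infinite tensor product and the action -/

section Algebra

variable (n : ℕ → ℕ) [∀ l, NeZero (n l)]

/-- The UHF algebra `⨂ₗ M_{nₗ}`, as the C*-algebra generated by the mutually commuting unital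
copies of the matrix algebras `M_{nₗ}` on `ℓ²(X)`. -/
def uhfSubalgebra : StarSubalgebra ℂ (Hilb n →L[ℂ] Hilb n) :=
  (⨆ l, (factorHom n l).range).topologicalClosure

instance : IsClosed (uhfSubalgebra n : Set (Hilb n →L[ℂ] Hilb n)) :=
  StarSubalgebra.isClosed_topologicalClosure _

/-- The UHF algebra `⨂ₗ M_{nₗ}` as a C*-algebra in its own right. -/
abbrev UHF : Type := uhfSubalgebra n

theorem factorHom_mem (l : ℕ) (a : Matrix (ZMod (n l)) (ZMod (n l)) ℂ) :
    factorHom n l a ∈ uhfSubalgebra n :=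
  StarSubalgebra.le_topologicalClosure _
    (le_iSup (fun l => (factorHom n l).range) l ⟨a, rfl⟩)

/-- The inclusion of the `l`-th tensor factor into `⨂ₗ M_{nₗ}`. -/
def factor (l : ℕ) : Matrix (ZMod (n l)) (ZMod (n l)) ℂ →⋆ₐ[ℂ] UHF n :=
  (factorHom n l).codRestrict (uhfSubalgebra n) (factorHom_mem n l)

instance : Nontrivial (UHF n) := by
  classical
  refine ⟨⟨1, 0, fun h => ?_⟩⟩
  have h1 : (1 : Hilb n →L[ℂ] Hilb n) = 0 := congrArg Subtype.val h
  have h2 := congrArg (fun T : Hilb n →L[ℂ] Hilb n => (T (lp.single 2 0 (1 : ℂ)) : Hilb n) 0) h1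
  simp at h2

/-- Each tensor factor is embedded faithfully. -/
theorem factor_injective (l : ℕ) : Function.Injective (factor n l) :=
  RingHom.injective (factor n l : Matrix (ZMod (n l)) (ZMod (n l)) ℂ →+* UHF n)

/-- The natural representation of `ℤ/nₗℤ` on `ℂ^{nₗ}` by cyclic permutations, `e_j ↦ e_{j+s}`. -/
def cyclicMatrix (l : ℕ) (s : ZMod (n l)) : Matrix (ZMod (n l)) (ZMod (n l)) ℂ :=
  Matrix.of fun i j => if i = j + s then 1 else 0

theorem conj_cyclicMatrix_apply (l : ℕ) (s : ZMod (n l))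
    (a : Matrix (ZMod (n l)) (ZMod (n l)) ℂ) (i j : ZMod (n l)) :
    (cyclicMatrix n l s * a * star (cyclicMatrix n l s)) i j = a (i - s) (j - s) := by
  have h : ∀ i k : ZMod (n l), (i = k + s) = (k = i - s) := fun i k =>
    propext ⟨fun h => by rw [h]; simp, fun h => by rw [h]; simp⟩
  simp [Matrix.mul_apply, cyclicMatrix, Matrix.star_apply, h]

theorem conj_translation_factorHom (g : CyclicProd n) (l : ℕ)
    (a : Matrix (ZMod (n l)) (ZMod (n l)) ℂ) :
    Unitary.conjStarAlgAut ℂ _ (translation n (Multiplicative.ofAdd g)) (factorHom n l a)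
      = factorHom n l (cyclicMatrix n l (g l) * a * star (cyclicMatrix n l (g l))) := by
  ext ξ x
  simp only [Unitary.conjStarAlgAut_apply, mul_apply_eq_comp, translation_apply,
    factorHom_apply, star_translation_apply, conj_cyclicMatrix_apply]
  rw [← (Equiv.subRight (g l)).sum_comp]
  refine Finset.sum_congr rfl fun j _ => ?_
  have h2 : Function.update (x - g) l (j - g l) + g = Function.update x l j := by
    ext m
    by_cases h : m = l
    · subst h; simp
    · simp [h]
  simp [h2]

theorem conj_translation_mem (g : Multiplicative (CyclicProd n)) {T : Hilb n →L[ℂ] Hilb n}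
    (hT : T ∈ uhfSubalgebra n) :
    Unitary.conjStarAlgAut ℂ _ (translation n g) T ∈ uhfSubalgebra n := by
  have hc : Continuous (Unitary.conjStarAlgAut ℂ (Hilb n →L[ℂ] Hilb n) (translation n g)) := by
    change Continuous fun T => (translation n g : Hilb n →L[ℂ] Hilb n) * T * _
    fun_prop
  have hle : (⨆ l, (factorHom n l).range) ≤ (uhfSubalgebra n).comap
      (Unitary.conjStarAlgAut ℂ (Hilb n →L[ℂ] Hilb n) (translation n g)).toStarAlgHom := by
    refine iSup_le fun l => ?_
    rintro _ ⟨a, rfl⟩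
    change Unitary.conjStarAlgAut ℂ _ (translation n (Multiplicative.ofAdd g.toAdd))
      (factorHom n l a) ∈ uhfSubalgebra n
    rw [conj_translation_factorHom]
    exact factorHom_mem n l _
  exact StarSubalgebra.topologicalClosure_minimal hle
    (IsClosed.preimage hc (StarSubalgebra.isClosed_topologicalClosure _)) hT

/-- The action of `∏ₗ ℤ/nₗℤ` on `⨂ₗ M_{nₗ}` by `⨂ₗ Ad(ρₗ(gₗ))`, where `ρₗ` is the natural
representation: conjugation by the translation unitary; see `prodAction_factor`. -/
def prodAction : Multiplicative (CyclicProd n) →* (UHF n ≃⋆ₐ[ℂ] UHF n) where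
  toFun g :=
    { toFun := fun T =>
        ⟨Unitary.conjStarAlgAut ℂ _ (translation n g) T, conj_translation_mem n g T.2⟩
      invFun := fun T =>
        ⟨Unitary.conjStarAlgAut ℂ _ (translation n g⁻¹) T, conj_translation_mem n g⁻¹ T.2⟩
      left_inv := fun T => Subtype.ext <| by
        dsimp only
        rw [← Unitary.conjStarAlgAut_mul_apply, ← map_mul]; simp
      right_inv := fun T => Subtype.ext <| by
        dsimp only
        rw [← Unitary.conjStarAlgAut_mul_apply, ← map_mul]; simp
      map_mul' := fun S T => Subtype.ext <| by simp only [MulMemClass.coe_mul, map_mul]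
      map_add' := fun S T => Subtype.ext <| by simp only [AddMemClass.coe_add, map_add]
      map_smul' := fun c T => Subtype.ext <| map_smul _ c (T : Hilb n →L[ℂ] Hilb n)
      map_star' := fun T => Subtype.ext <| map_star _ (T : Hilb n →L[ℂ] Hilb n) }
  map_one' := by
    ext T : 2
    change Unitary.conjStarAlgAut ℂ _ (translation n 1) (T : Hilb n →L[ℂ] Hilb n) = T
    simp
  map_mul' g h := by
    ext T : 2
    change Unitary.conjStarAlgAut ℂ _ (translation n (g * h)) (T : Hilb n →L[ℂ] Hilb n)
      = Unitary.conjStarAlgAut ℂ _ (translation n g)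
        (Unitary.conjStarAlgAut ℂ _ (translation n h) T)
    rw [map_mul, Unitary.conjStarAlgAut_mul_apply]

/-- On the `l`-th tensor factor the action is `Ad(ρₗ(gₗ))`. -/
theorem prodAction_factor (g : CyclicProd n) (l : ℕ) (a : Matrix (ZMod (n l)) (ZMod (n l)) ℂ) :
    prodAction n (Multiplicative.ofAdd g) (factor n l a)
      = factor n l (cyclicMatrix n l (g l) * a * star (cyclicMatrix n l (g l))) :=
  Subtype.ext (conj_translation_factorHom n g l a)

/-- The action of `G` on `⨂ₗ M_{nₗ}` obtained by composing `i : G → ∏ₗ ℤ/nₗℤ` with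
`prodAction`. -/
def modelAction {G : Type*} [AddCommGroup G] (i : G →+ CyclicProd n) :
    Multiplicative G →* (UHF n ≃⋆ₐ[ℂ] UHF n) :=
  (prodAction n).comp (AddMonoidHom.toMultiplicative i)

end Algebra

end UHFModel

end

/-!
If `g` lies in the direct sum, the translation by `g` is a product of finitely many permutation
matrices in different tensor factors, so `g` acts by an inner automorphism. An inner automorphism
`Ad u` has no Rokhlin property beyond order one: projections almost commuting with `u` are almost
fixed rather than moved, and `‖q * u⁎ * Ad u (q)‖ = ‖q‖`.

Conversely, if `⟨g⟩` meets the direct sum only trivially, then its non-zero elements are visible on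
coordinates beyond any given finite set. Projections given by functions of such coordinates commute
with any prescribed local elements. Colouring `∏_{l ∈ s} ℤ/nₗℤ` by points makes every colour class
disjoint from its translate, and colouring each coset of `⟨g⟩` cyclically makes the translation
permute the colour classes cyclically. For uniform outerness, an arbitrary projection `p` must be
cut: a unitary close to `1` conjugates `p` to a projection obtained by functional calculus from a
local element, which commutes with the colour classes.
-/

namespace UHFModel

section Perturbation

variable {A : Type*} [CStarAlgebra A]

theorem abs_sub_ite_half_lt_le_two_mul_abs (x : ℝ) :
    |x - if 1 / 2 < x then 1 else 0| ≤ 2 * |x * x - x| := by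
  rw [← mul_sub_one, abs_mul, ← mul_assoc]
  split_ifs with hx
  · rw [abs_of_pos (by linarith : 0 < x)]
    exact le_mul_of_one_le_left (abs_nonneg _) (by linarith)
  · rw [sub_zero, mul_right_comm, abs_of_neg (by linarith : x - 1 < 0)]
    exact le_mul_of_one_le_left (abs_nonneg _) (by linarith)

theorem exists_isStarProjection_norm_sub_le {b : A} (hb : IsSelfAdjoint b)
    (hbb : ‖b * b - b‖ < 1 / 4) :
    ∃ q : A, IsStarProjection q ∧ ‖b - q‖ ≤ 2 * ‖b * b - b‖ ∧
      ∀ c, Commute b c → Commute q c := by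
  have hspec : ∀ x ∈ spectrum ℝ b, |x * x - x| ≤ ‖b * b - b‖ := fun x hx => by
    have h := norm_apply_le_norm_cfc (fun x : ℝ => x * x - x) b hx
    rwa [cfc_sub (fun x : ℝ => x * x) (fun x => x) b, cfc_mul (fun x : ℝ => x) (fun x => x) b,
      cfc_id' ℝ b] at h
  let χ : ℝ → ℝ := fun x => if 1 / 2 < x then 1 else 0
  have hχ : ContinuousOn χ (spectrum ℝ b) := by
    refine ContinuousOn.if ?_ continuousOn_const continuousOn_const
    rintro x ⟨hx, hfrontier⟩
    have hx_eq : x = 1 / 2 := frontier_Ioi.subset hfrontier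
    have := (hspec x hx).trans_lt hbb
    norm_num [hx_eq] at this
  refine ⟨cfc χ b, ⟨?_, IsSelfAdjoint.cfc⟩, ?_, fun c hc => hc.cfc_real χ⟩
  · rw [IsIdempotentElem, ← cfc_mul χ χ b]
    congr 1
    ext x
    by_cases hx : 1 / 2 < x <;> simp only [χ, hx, if_true, if_false, mul_one, mul_zero]
  · have hsub : b - cfc χ b = cfc (fun x => x - χ x) b := by
      rw [cfc_sub (fun x => x) χ b, cfc_id' ℝ b]
    rw [hsub]
    refine norm_cfc_le (by positivity) fun x hx => ?_
    exact (abs_sub_ite_half_lt_le_two_mul_abs x).trans (by gcongr; exact hspec x hx)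

theorem abs_sqrt_sub_one_le_abs_sub_one {x : ℝ} (hx : 0 ≤ x) : |√x - 1| ≤ |x - 1| := by
  have hfactor : x - 1 = (√x - 1) * (√x + 1) := by
    linear_combination -Real.mul_self_sqrt hx
  rw [hfactor, abs_mul, abs_of_pos (by positivity : 0 < √x + 1)]
  exact le_mul_of_one_le_right (abs_nonneg _) (by linarith [Real.sqrt_nonneg x])

theorem norm_cfc_sqrt_sub_one_le (z : A) :
    ‖cfc Real.sqrt (star z * z) - 1‖ ≤ ‖star z * z - 1‖ := by
  have hsub : cfc Real.sqrt (star z * z) - 1 = cfc (fun x => √x - 1) (star z * z) := by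
    rw [cfc_sub Real.sqrt (fun _ => 1) (star z * z), cfc_const_one ℝ (star z * z)]
  rw [hsub]
  refine norm_cfc_le (norm_nonneg _) fun x hx => ?_
  refine (abs_sqrt_sub_one_le_abs_sub_one (spectrum_star_mul_self_nonneg x hx)).trans ?_
  have h := norm_apply_le_norm_cfc (fun x : ℝ => x - 1) (star z * z) hx
  rwa [cfc_sub (fun x : ℝ => x) (fun _ => 1) (star z * z), cfc_id' ℝ (star z * z),
    cfc_const_one ℝ (star z * z)] at h

theorem cfc_sqrt_mul_self (z : A) :
    cfc Real.sqrt (star z * z) * cfc Real.sqrt (star z * z) = star z * z := by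
  rw [← cfc_mul Real.sqrt Real.sqrt (star z * z)]
  conv_rhs => rw [← cfc_id' ℝ (star z * z)]
  exact cfc_congr fun x hx => Real.mul_self_sqrt (spectrum_star_mul_self_nonneg x hx)

theorem exists_unitary_mul_cfc_sqrt_eq {z : A} (hz : IsUnit z) :
    ∃ u : unitary A, IsUnit (cfc Real.sqrt (star z * z)) ∧
      u * cfc Real.sqrt (star z * z) = z := by
  have hr : IsUnit (cfc Real.sqrt (star z * z)) := by
    rw [← isUnit_pow_iff two_ne_zero, pow_two, cfc_sqrt_mul_self]
    exact hz.star.mul hz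
  refine ⟨⟨hz.unit * hr.unit⁻¹, (Units.mul_inv_mem_unitary _ _).2 (Units.ext ?_)⟩, hr, ?_⟩
  · simpa [IsSelfAdjoint.cfc.star_eq] using (cfc_sqrt_mul_self z).symm
  · simp [mul_assoc]

theorem exists_unitary_conj_eq_of_intertwining {p q z : A} (hp : IsSelfAdjoint p)
    (hq : IsSelfAdjoint q) (hz : IsUnit z) (hpz : p * z = z * q) :
    ∃ u : unitary A, ‖(u : A) - 1‖ ≤ ‖z - 1‖ + ‖star z * z - 1‖ ∧ u * q * star (u : A) = p := by
  obtain ⟨u, hr, hur⟩ := exists_unitary_mul_cfc_sqrt_eq hz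
  set r := cfc Real.sqrt (star z * z)
  have hzq : q * star z = star z * p := by
    simpa [hp.star_eq, hq.star_eq] using (congrArg star hpz).symm
  have hcomm : Commute (star z * z) q := by
    rw [commute_iff_eq, mul_assoc, ← hpz, ← mul_assoc, ← hzq, mul_assoc]
  have hrq : Commute r q := hcomm.cfc_real Real.sqrt
  have huq : u * q = p * u := by
    rw [← hr.mul_left_inj, mul_assoc, ← hrq.eq, ← mul_assoc, mul_assoc p, hur, hpz]
  refine ⟨u, ?_, by rw [huq, mul_assoc, Unitary.mul_star_self_of_mem u.2, mul_one]⟩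
  calc ‖(u : A) - 1‖ = ‖(z - 1) - u * (r - 1)‖ := by rw [mul_sub_one, hur]; abel_nf
    _ ≤ ‖z - 1‖ + ‖u * (r - 1)‖ := norm_sub_le _ _
    _ ≤ ‖z - 1‖ + ‖star z * z - 1‖ := by
      rw [CStarRing.norm_coe_unitary_mul]
      gcongr
      exact norm_cfc_sqrt_sub_one_le z

theorem exists_unitary_conj_eq_of_norm_sub_lt {p q : A} (hp : IsStarProjection p)
    (hq : IsStarProjection q) (hpq : ‖p - q‖ < 1 / 2) :
    ∃ u : unitary A, ‖(u : A) - 1‖ ≤ 3 * ‖p - q‖ ∧ u * q * star (u : A) = p := by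
  have hpp : p * p = p := hp.isIdempotentElem
  have hqq : q * q = q := hq.isIdempotentElem
  let z := p * q + (1 - p) * (1 - q)
  have hpz : p * z = z * q := by
    rw [mul_add, ← mul_assoc, ← mul_assoc, hpp, hp.mul_one_sub_self, add_mul, mul_assoc, mul_assoc,
      hqq, hq.one_sub_mul_self, zero_mul, mul_zero]
  have hz : ‖z - 1‖ ≤ 2 * ‖p - q‖ := by
    have hz_eq : z - 1 = (p - q) * q - p * (p - q) := by
      simp only [z, mul_sub, sub_mul, one_mul, mul_one, hpp, hqq]
      abel
    rw [hz_eq, two_mul]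
    refine (norm_sub_le _ _).trans (add_le_add ?_ ?_)
    · exact (norm_mul_le _ _).trans (mul_le_of_le_one_right (norm_nonneg _) (hq.norm_le _))
    · exact (norm_mul_le _ _).trans (mul_le_of_le_one_left (norm_nonneg _) (hp.norm_le _))
  have hzz : ‖star z * z - 1‖ ≤ ‖p - q‖ := by
    have hzz_eq : star z * z - 1 = -((p - q) * (p - q)) := by
      have hpp' (x : A) : p * (p * x) = p * x := by rw [← mul_assoc, hpp]
      simp only [z, star_add, star_mul, star_sub, star_one, hp.isSelfAdjoint.star_eq,
        hq.isSelfAdjoint.star_eq, mul_add, add_mul, mul_sub, sub_mul, one_mul, mul_one, mul_assoc,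
        hpp', hpp, hqq]
      abel
    rw [hzz_eq, norm_neg]
    exact (norm_mul_le _ _).trans (mul_le_of_le_one_left (norm_nonneg _) (by linarith))
  have hunit : IsUnit z := by
    rw [← sub_sub_cancel 1 z]
    exact isUnit_one_sub_of_norm_lt_one (by rw [norm_sub_rev]; linarith)
  obtain ⟨u, hu, huq⟩ := exists_unitary_conj_eq_of_intertwining hp.isSelfAdjoint hq.isSelfAdjoint
    hunit hpz
  exact ⟨u, by linarith, huq⟩

theorem norm_mul_self_sub_self_le {p b : A} (hp : IsStarProjection p) (hpb : ‖p - b‖ ≤ 1) :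
    ‖b * b - b‖ ≤ 4 * ‖p - b‖ := by
  have hp_norm : ‖p‖ ≤ 1 := hp.norm_le _
  have hb : ‖b‖ ≤ 2 := by
    calc ‖b‖ = ‖p - (p - b)‖ := by rw [sub_sub_cancel]
      _ ≤ 2 := (norm_sub_le _ _).trans (by linarith)
  have hdecomp : b * b - b = (p - b) - (b * (p - b) + (p - b) * p) := by
    rw [mul_sub, sub_mul, hp.isIdempotentElem.eq]
    abel
  calc ‖b * b - b‖ ≤ ‖p - b‖ + (‖b‖ * ‖p - b‖ + ‖p - b‖ * ‖p‖) := by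
        rw [hdecomp]
        refine (norm_sub_le _ _).trans (add_le_add_right ((norm_add_le _ _).trans ?_) _)
        exact add_le_add (norm_mul_le _ _) (norm_mul_le _ _)
    _ ≤ ‖p - b‖ + (2 * ‖p - b‖ + ‖p - b‖ * 1) := by gcongr
    _ = 4 * ‖p - b‖ := by ring

theorem exists_isStarProjection_unitary_conj_eq {p b : A} (hp : IsStarProjection p)
    (hb : IsSelfAdjoint b) (hpb : ‖p - b‖ < 1 / 18) :
    ∃ (u : unitary A) (q : A), IsStarProjection q ∧ ‖(u : A) - 1‖ ≤ 27 * ‖p - b‖ ∧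
      u * q * star (u : A) = p ∧ ∀ c, Commute b c → Commute q c := by
  have hbb := norm_mul_self_sub_self_le hp (by linarith)
  obtain ⟨q, hq, hbq, hcomm⟩ := exists_isStarProjection_norm_sub_le hb (by linarith)
  have hpq : ‖p - q‖ ≤ 9 * ‖p - b‖ := by
    linarith [norm_sub_le_norm_sub_add_norm_sub p b q]
  obtain ⟨u, hu, huq⟩ := exists_unitary_conj_eq_of_norm_sub_lt hp hq (by linarith)
  exact ⟨u, q, hq, by linarith, huq, hcomm⟩

end Perturbation

section Partition

/-- A partition of `p` into mutually orthogonal projections `q i`, as in the definitions of uniform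
outerness and of the Rokhlin property; some of the `q i` may vanish. -/
structure IsProjectionPartition {ι R : Type*} [Fintype ι] [NonUnitalSemiring R] [Star R]
    (q : ι → R) (p : R) : Prop where
  isStarProjection (i : ι) : IsStarProjection (q i)
  mul_eq_zero_of_ne {i j : ι} (hij : i ≠ j) : q i * q j = 0
  sum_eq : ∑ i, q i = p

namespace IsProjectionPartition

variable {ι R S F : Type*} [Fintype ι] [NonUnitalSemiring R] [StarRing R] {q : ι → R} {p : R}

theorem map [NonUnitalSemiring S] [StarRing S] [FunLike F R S] [NonUnitalRingHomClass F R S]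
    [StarHomClass F R S] (hq : IsProjectionPartition q p) (φ : F) :
    IsProjectionPartition (fun i => φ (q i)) (φ p) where
  isStarProjection i := (hq.isStarProjection i).map φ
  mul_eq_zero_of_ne hij := by rw [← map_mul, hq.mul_eq_zero_of_ne hij, map_zero]
  sum_eq := by rw [← map_sum, hq.sum_eq]

theorem mul_left (hq : IsProjectionPartition q p) {e : R} (he : IsStarProjection e)
    (hcomm : ∀ i, Commute e (q i)) : IsProjectionPartition (fun i => e * q i) (e * p) where
  isStarProjection i := he.mul (hq.isStarProjection i) (hcomm i)
  mul_eq_zero_of_ne {i j} hij := by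
    rw [(hcomm i).symm.mul_mul_mul_comm, hq.mul_eq_zero_of_ne hij, mul_zero]
  sum_eq := by rw [← Finset.mul_sum, hq.sum_eq]

end IsProjectionPartition

theorem isProjectionPartition_ite_eq {X K R : Type*} [Fintype K] [DecidableEq K] [Semiring R]
    [StarRing R] (c : X → K) :
    IsProjectionPartition (fun k x => if c x = k then (1 : R) else 0) 1 where
  isStarProjection k := by
    constructor <;> ext x <;> by_cases hx : c x = k <;> simp [hx]
  mul_eq_zero_of_ne {k l} hkl := by
    ext x
    by_cases hx : c x = k
    · simp [hx, hkl]
    · simp [hx]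
  sum_eq := by
    ext x
    simp

end Partition

section Criteria

open scoped ComplexStarModule

variable {A : Type*} [CStarAlgebra A] {β : A ≃⋆ₐ[ℂ] A}

theorem norm_star_mul_mul_apply_sub_le (β : A ≃⋆ₐ[ℂ] A) (u : unitary A) (a : A) :
    ‖star (u : A) * a * β u - a‖ ≤ 2 * ‖(u : A) - 1‖ * ‖a‖ := by
  have hβ : ‖β u - 1‖ = ‖(u : A) - 1‖ := by
    rw [← StarAlgEquiv.norm_map β ((u : A) - 1), map_sub, map_one]
  have hdecomp : star (u : A) * a * β u - a
      = star (u : A) * (a * (β u - 1) - (u - 1) * a) := by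
    simp only [mul_sub, sub_mul, mul_one, one_mul, ← mul_assoc, Unitary.coe_star_mul_self]
    abel
  rw [hdecomp, ← Unitary.coe_star, CStarRing.norm_coe_unitary_mul]
  calc ‖a * (β u - 1) - (u - 1) * a‖ ≤ ‖a‖ * ‖β u - 1‖ + ‖(u : A) - 1‖ * ‖a‖ :=
        (norm_sub_le _ _).trans (add_le_add (norm_mul_le _ _) (norm_mul_le _ _))
    _ = 2 * ‖(u : A) - 1‖ * ‖a‖ := by rw [hβ]; ring

theorem norm_conj_mul_mul_apply_conj_le (u : unitary A) {f : A} (hf : IsStarProjection f) (a : A)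
    {a' : A} (ha' : f * a' * β f = 0) :
    ‖u * f * star (u : A) * a * β (u * f * star (u : A))‖ ≤ ‖star (u : A) * a * β u - a'‖ := by
  have hβu : star (β u) ∈ unitary A := Unitary.star_mem (Unitary.map_mem β u.2)
  have hcorner : u * f * star (u : A) * a * β (u * f * star (u : A))
      = u * (f * (star (u : A) * a * β u - a') * β f) * star (β u) := by
    rw [mul_sub, sub_mul, ha', sub_zero, map_mul, map_mul, map_star]
    simp only [mul_assoc]
  rw [hcorner, CStarRing.norm_mul_mem_unitary _ hβu, CStarRing.norm_coe_unitary_mul]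
  calc ‖f * (star (u : A) * a * β u - a') * β f‖
      ≤ ‖f‖ * ‖star (u : A) * a * β u - a'‖ * ‖β f‖ :=
        (norm_mul_le _ _).trans (by gcongr; exact norm_mul_le _ _)
    _ ≤ 1 * ‖star (u : A) * a * β u - a'‖ * 1 := by
        gcongr
        exacts [hf.norm_le _, (hf.map β).norm_le _]
    _ = ‖star (u : A) * a * β u - a'‖ := by ring

theorem commute_realPart_of_isSelfAdjoint {b e : A} (he : IsSelfAdjoint e) (hbe : Commute b e) :
    Commute (ℜ b : A) e := by
  have hbe_star : Commute (star b) e := by simpa only [he.star_eq] using hbe.star_star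
  rw [realPart_apply_coe]
  exact (hbe.add_left hbe_star).smul_left _

theorem exists_mem_unitary_conj_eq_of_dense {D : Set A} (hD : Dense D) {p : A}
    (hp : IsStarProjection p) {δ : ℝ} (hδ : 0 < δ) :
    ∃ b ∈ D, ∃ (u : unitary A) (q : A), IsStarProjection q ∧ ‖(u : A) - 1‖ < δ ∧
      u * q * star (u : A) = p ∧ ∀ e, IsSelfAdjoint e → Commute b e → Commute q e := by
  obtain ⟨b, hbD, hb⟩ := hD.exists_dist_lt p (show 0 < min (1 / 18) (δ / 27) by positivity)
  have hpb : ‖p - ℜ b‖ < min (1 / 18) (δ / 27) := by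
    rw [← hp.isSelfAdjoint.coe_realPart, ← AddSubgroupClass.coe_sub, ← map_sub]
    exact (realPart.norm_le (p - b)).trans_lt (by rwa [← dist_eq_norm])
  obtain ⟨hpb_lt, hpb_δ⟩ := lt_min_iff.1 hpb
  obtain ⟨u, q, hq, hu, huq, hq_comm⟩ := exists_isStarProjection_unitary_conj_eq hp (ℜ b).2 hpb_lt
  exact ⟨b, hbD, u, q, hq, by linarith, huq,
    fun e he hbe => hq_comm e (commute_realPart_of_isSelfAdjoint he hbe)⟩

theorem mul_mul_mul_apply_mul_eq_zero {a e q : A} (hqe : Commute q e) (hae : Commute a e)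
    (heβ : e * β e = 0) : q * e * a * β (q * e) = 0 := by
  calc q * e * a * β (q * e) = q * (e * a * β e) * β q := by
        rw [hqe.eq, map_mul, ← hqe.eq]
        simp only [mul_assoc]
    _ = 0 := by rw [← hae.eq, mul_assoc a, heβ, mul_zero, mul_zero, zero_mul]

theorem isUniformlyOuter_of_dense {D : Set A} (hD : Dense D)
    (h : ∀ F : Finset A, ↑F ⊆ D → ∃ (k : ℕ) (e : Fin k → A), IsProjectionPartition e 1 ∧
      (∀ i, e i * β (e i) = 0) ∧ ∀ i, ∀ a ∈ F, Commute a (e i)) :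
    IsUniformlyOuter β := by
  classical
  intro a p hp hp0 ε hε
  obtain ⟨δ, hδ, hδε⟩ := exists_pos_mul_lt (half_pos hε) (2 * ‖a‖)
  obtain ⟨a', ha'D, ha'⟩ := hD.exists_dist_lt a (half_pos hε)
  obtain ⟨b, hbD, u, q, hq, hu, huq, hq_comm⟩ := exists_mem_unitary_conj_eq_of_dense hD hp hδ
  obtain ⟨k, e, he, heβ, hcomm⟩ := h {a', b} (by simp [Set.insert_subset_iff, ha'D, hbD])
  have hqe (i) : Commute q (e i) :=
    hq_comm _ (he.isStarProjection i).isSelfAdjoint (hcomm i b (by simp))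
  have hqe_part : IsProjectionPartition (fun i => q * e i) q := by
    simpa only [mul_one] using he.mul_left hq hqe
  have hpart : IsProjectionPartition (fun i => u * (q * e i) * star (u : A)) p := by
    simpa only [Unitary.conjStarAlgAut_apply, huq] using
      hqe_part.map (Unitary.conjStarAlgAut ℂ A u)
  refine ⟨k, Nat.pos_of_ne_zero ?_, _, hpart.isStarProjection, fun i j => hpart.mul_eq_zero_of_ne,
    hpart.sum_eq.symm, fun i => ?_⟩
  · rintro rfl
    exact hp0 (by rw [← hpart.sum_eq, Fin.sum_univ_zero])
  calc ‖u * (q * e i) * star (u : A) * a * β (u * (q * e i) * star (u : A))‖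
      ≤ ‖star (u : A) * a * β u - a'‖ := norm_conj_mul_mul_apply_conj_le u
        (hqe_part.isStarProjection i) a
        (mul_mul_mul_apply_mul_eq_zero (hqe i) (hcomm i a' (by simp)) (heβ i))
    _ ≤ ‖star (u : A) * a * β u - a‖ + ‖a - a'‖ := norm_sub_le_norm_sub_add_norm_sub _ _ _
    _ ≤ 2 * ‖a‖ * δ + ‖a - a'‖ := by
        rw [mul_right_comm]
        gcongr
        exact (norm_star_mul_mul_apply_sub_le β u a).trans (by gcongr)
    _ < ε := by
        rw [dist_eq_norm] at ha'
        linarith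

theorem hasFiniteOrderRokhlin_of_dense {k : ℕ} {D : Set A} (hD : Dense D)
    (h : ∀ F : Finset A, ↑F ⊆ D → ∃ e : Fin k → A, IsProjectionPartition e 1 ∧
      (∀ i, β (e i) = e (finRotate k i)) ∧ ∀ i, ∀ a ∈ F, Commute a (e i)) :
    HasFiniteOrderRokhlin k β := by
  classical
  intro ε hε F
  choose y hyD hy using fun a => hD.exists_dist_lt a (half_pos hε)
  obtain ⟨e, he, heβ, hcomm⟩ := h (F.image y) (by simp [Set.subset_def, hyD])
  refine ⟨e, he.isStarProjection, fun i j => he.mul_eq_zero_of_ne, fun i a ha => ?_, fun i => by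
    simpa [heβ] using hε, he.sum_eq⟩
  have hdecomp : e i * a - a * e i = e i * (a - y a) - (a - y a) * e i := by
    rw [mul_sub, sub_mul, (hcomm i (y a) (Finset.mem_image_of_mem y ha)).eq]
    abel
  have hnorm : ‖e i‖ ≤ 1 := (he.isStarProjection i).norm_le _
  calc ‖e i * a - a * e i‖ ≤ ‖e i‖ * ‖a - y a‖ + ‖a - y a‖ * ‖e i‖ := by
        rw [hdecomp]
        exact (norm_sub_le _ _).trans (add_le_add (norm_mul_le _ _) (norm_mul_le _ _))
    _ ≤ 1 * ‖a - y a‖ + ‖a - y a‖ * 1 := by gcongr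
    _ < ε := by
      have := hy a
      rw [dist_eq_norm] at this
      linarith

end Criteria

section Inner

theorem eq_zero_of_isIdempotentElem_of_norm_sub_lt_one {R : Type*} [NonUnitalNormedRing R] {p q : R}
    (hp : IsIdempotentElem p) (hpq : p * q = 0) (hlt : ‖p - q‖ < 1) : p = 0 := by
  have hle : ‖p‖ ≤ ‖p‖ * ‖p - q‖ := by
    simpa only [mul_sub, hp.eq, hpq, sub_zero] using norm_mul_le p (p - q)
  by_contra hp0
  exact hle.not_gt (mul_lt_of_lt_one_right (norm_pos_iff.2 hp0) hlt)

theorem norm_conjStarAlgAut_apply_sub {A : Type*} [CStarAlgebra A] (u : unitary A) (p : A) :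
    ‖Unitary.conjStarAlgAut ℂ A u p - p‖ = ‖p * u - u * p‖ := by
  rw [← CStarRing.norm_mul_coe_unitary _ u, sub_mul, Unitary.conjStarAlgAut_apply, mul_assoc,
    Unitary.coe_star_mul_self, mul_one, norm_sub_rev]

variable {A : Type*} [CStarAlgebra A] [Nontrivial A] {u : unitary A}

theorem not_isUniformlyOuter_conjStarAlgAut :
    ¬ IsUniformlyOuter (Unitary.conjStarAlgAut ℂ A u) := by
  intro h
  obtain ⟨k, -, q, hq, -, hsum, hnorm⟩ := h (star (u : A)) 1 (.one A) one_ne_zero 1 one_pos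
  refine one_ne_zero (hsum.trans (Finset.sum_eq_zero fun i _ => ?_))
  have hcorner : q i * star (u : A) * Unitary.conjStarAlgAut ℂ A u (q i)
      = q i * (star u : unitary A) := by
    rw [Unitary.conjStarAlgAut_apply, Unitary.coe_star]
    simp only [← mul_assoc]
    rw [mul_assoc (q i), Unitary.coe_star_mul_self, mul_one, (hq i).isIdempotentElem.eq]
  have hlt := hnorm i
  rw [hcorner, CStarRing.norm_mul_coe_unitary] at hlt
  exact eq_zero_of_isIdempotentElem_of_norm_sub_lt_one (hq i).isIdempotentElem (mul_zero _)
    (by rwa [sub_zero])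

theorem finRotate_apply_ne {k : ℕ} (hk : k ≠ 1) (i : Fin k) : finRotate k i ≠ i := by
  obtain ⟨m, rfl⟩ : ∃ m, k = m + 2 := ⟨k - 2, by have := i.pos; omega⟩
  simp [finRotate_apply]

theorem eq_one_of_hasFiniteOrderRokhlin_conjStarAlgAut {k : ℕ}
    (h : HasFiniteOrderRokhlin k (Unitary.conjStarAlgAut ℂ A u)) : k = 1 := by
  by_contra hk
  obtain ⟨p, hp, horth, hcomm, hshift, hsum⟩ := h (1 / 2) one_half_pos {(u : A)}
  refine one_ne_zero (hsum.symm.trans (Finset.sum_eq_zero fun i _ => ?_))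
  refine eq_zero_of_isIdempotentElem_of_norm_sub_lt_one (hp i).isIdempotentElem
    (horth i _ (finRotate_apply_ne hk i).symm) ?_
  calc ‖p i - p (finRotate k i)‖
      ≤ ‖p i - Unitary.conjStarAlgAut ℂ A u (p i)‖
        + ‖Unitary.conjStarAlgAut ℂ A u (p i) - p (finRotate k i)‖ :=
        norm_sub_le_norm_sub_add_norm_sub _ _ _
    _ < 1 / 2 + 1 / 2 := by
        refine add_lt_add ?_ (hshift i)
        rw [norm_sub_rev, norm_conjStarAlgAut_apply_sub]
        exact hcomm i u (Finset.mem_singleton_self _)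
    _ = 1 := add_halves 1

theorem HasRokhlinProperty.eq_zero_of_apply_eq_conjStarAlgAut {G : Type*} [AddCommGroup G]
    {α : Multiplicative G →* (A ≃⋆ₐ[ℂ] A)} (h : HasRokhlinProperty α) {g : G}
    (hg : α (Multiplicative.ofAdd g) = Unitary.conjStarAlgAut ℂ A u) : g = 0 := by
  obtain ⟨hfin, hinf⟩ := h g
  rw [hg] at hfin hinf
  rcases Nat.eq_zero_or_pos (addOrderOf g) with h0 | hpos
  · exact absurd (pow_one (Unitary.conjStarAlgAut ℂ A u) ▸ hinf h0 1 le_rfl)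
      not_isUniformlyOuter_conjStarAlgAut
  · exact AddMonoid.addOrderOf_eq_one_iff.1
      (eq_one_of_hasFiniteOrderRokhlin_conjStarAlgAut (hfin hpos))

end Inner

theorem exists_add_eq_finRotate {H : Type*} [AddGroup H] {h : H} (hh : 0 < addOrderOf h) :
    ∃ c : H → Fin (addOrderOf h), ∀ x, c (x + h) = finRotate _ (c x) := by
  have : NeZero (addOrderOf h) := ⟨hh.ne'⟩
  let π : H → H ⧸ AddSubgroup.zmultiples h := QuotientAddGroup.mk
  have hcoset (x : H) : ∃ m : ℤ, m • h = -(π x).out + x :=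
    AddSubgroup.mem_zmultiples_iff.1 (QuotientAddGroup.eq.1 (QuotientAddGroup.out_eq' (π x)))
  choose m hm using hcoset
  refine ⟨fun x => (ZMod.finEquiv _).symm (m x), fun x => ?_⟩
  have hπ : π (x + h) = π x := QuotientAddGroup.eq.2 (by simp)
  have hstep : m (x + h) • h = (m x + 1) • h := by
    rw [add_one_zsmul, hm, hm, hπ, add_assoc]
  have hcast : (m (x + h) : ZMod (addOrderOf h)) = m x + 1 := by
    exact_mod_cast (ZMod.intCast_eq_intCast_iff _ _ _).2 (zsmul_eq_zsmul_iff_modEq.1 hstep)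
  dsimp only
  rw [finRotate_apply, hcast, map_add, map_one]

theorem exists_finset_disjoint_addOrderOf_restrict_eq {n : ℕ → ℕ} {g : CyclicProd n}
    (hpos : 0 < addOrderOf g) (hg : ∀ m : ℕ, m • g ∈ cyclicSum n → m • g = 0)
    (t : Finset ℕ) :
    ∃ s : Finset ℕ, Disjoint s t ∧ addOrderOf (s.restrict g) = addOrderOf g := by
  have hex (m : ℕ) (hm : m • g ≠ 0) : ∃ l ∉ t, m • g l ≠ 0 := by
    have hinf : {l | (m • g) l ≠ 0}.Infinite := fun h => hm (hg m h)
    obtain ⟨l, hl, hlt⟩ := hinf.exists_notMem_finset t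
    exact ⟨l, hlt, hl⟩
  choose! l hlt hl using hex
  have hne {m : ℕ} (hm : m ∈ Finset.Ioo 0 (addOrderOf g)) : m • g ≠ 0 := by
    rw [Finset.mem_Ioo] at hm
    exact mt addOrderOf_dvd_of_nsmul_eq_zero (Nat.not_dvd_of_pos_of_lt hm.1 hm.2)
  refine ⟨(Finset.Ioo 0 (addOrderOf g)).image l, ?_, (addOrderOf_eq_iff hpos).2
    ⟨?_, fun m hm h0 h => ?_⟩⟩
  · simp only [Finset.disjoint_left, Finset.forall_mem_image]
    exact fun m hm => hlt m (hne hm)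
  · exact congrArg (Finset.restrict _) (addOrderOf_nsmul_eq_zero g)
  · have hm' := Finset.mem_Ioo.2 ⟨h0, hm⟩
    exact hl m (hne hm') (congrFun h ⟨l m, Finset.mem_image_of_mem l hm'⟩)

section Multiplication

variable {X Y : Type*} [Finite Y]

/-- The representation of `ℂ^Y`, for a finite set `Y`, on `ℓ²(X)` by multiplication operators along
a map `r : X → Y`. -/
noncomputable def multiplicationAlong (r : X → Y) :
    (Y → ℂ) →⋆ₐ[ℂ] (lp (fun _ : X => ℂ) 2 →L[ℂ] lp (fun _ : X => ℂ) 2) where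
  toFun f := lp.holderL (p := ⊤) 2 (fun _ => ContinuousLinearMap.mul ℂ ℂ) (K := 1)
    (fun _ => ContinuousLinearMap.opNorm_mul_le ℂ ℂ)
    ⟨fun x => f (r x), memℓp_infty ((Set.finite_range fun y => ‖f y‖).bddAbove.mono
      (Set.range_comp_subset_range r fun y => ‖f y‖))⟩
  map_one' := by ext ξ x; exact one_mul _
  map_mul' f g := by ext ξ x; exact mul_assoc _ _ _
  map_zero' := by ext ξ x; exact zero_mul _
  map_add' f g := by ext ξ x; exact add_mul _ _ _
  commutes' c := by ext ξ x; rfl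
  map_star' f := by
    rw [ContinuousLinearMap.star_eq_adjoint, ContinuousLinearMap.eq_adjoint_iff]
    intro ξ η
    rw [lp.inner_eq_tsum, lp.inner_eq_tsum]
    refine tsum_congr fun x => ?_
    change η x * starRingEnd ℂ (starRingEnd ℂ (f (r x)) * ξ x) = f (r x) * η x * starRingEnd ℂ (ξ x)
    rw [map_mul, Complex.conj_conj]
    ring

@[simp]
theorem multiplicationAlong_apply (r : X → Y) (f : Y → ℂ) (ξ : lp (fun _ : X => ℂ) 2) (x : X) :
    multiplicationAlong r f ξ x = f (r x) * ξ x := rfl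

end Multiplication

variable {n : ℕ → ℕ} [∀ l, NeZero (n l)]

section DirectSum

theorem translation_single (l : ℕ) (s : ZMod (n l)) :
    (translation n (Multiplicative.ofAdd (Pi.single l s)) : Hilb n →L[ℂ] Hilb n)
      = factorHom n l (cyclicMatrix n l s) := by
  ext ξ x
  have hupdate : x - Pi.single l s = Function.update x l (x l - s) := by
    ext m
    rcases eq_or_ne m l with rfl | h <;> simp [*]
  simp [factorHom_apply, cyclicMatrix, hupdate, ← sub_eq_iff_eq_add]

theorem translation_mem_uhfSubalgebra {g : CyclicProd n} (hg : g ∈ cyclicSum n) :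
    (translation n (Multiplicative.ofAdd g) : Hilb n →L[ℂ] Hilb n) ∈ uhfSubalgebra n := by
  have hfin : {l | g l ≠ 0}.Finite := hg
  have hsum : g = ∑ l ∈ hfin.toFinset, Pi.single l (g l) := by
    ext m
    by_cases hm : g m = 0 <;> simp [Finset.sum_apply, Finset.sum_pi_single, hm]
  rw [hsum]
  refine Finset.sum_induction _ (fun h => (translation n (Multiplicative.ofAdd h) :
    Hilb n →L[ℂ] Hilb n) ∈ uhfSubalgebra n) (fun g h hg hh => ?_) ?_ fun l _ => ?_
  · rw [ofAdd_add, map_mul]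
    exact mul_mem hg hh
  · rw [ofAdd_zero, map_one]
    exact one_mem _
  · rw [translation_single]
    exact factorHom_mem n l _

theorem exists_prodAction_eq_conjStarAlgAut {g : CyclicProd n} (hg : g ∈ cyclicSum n) :
    ∃ u : unitary (UHF n),
      prodAction n (Multiplicative.ofAdd g) = Unitary.conjStarAlgAut ℂ (UHF n) u :=
  ⟨⟨⟨_, translation_mem_uhfSubalgebra hg⟩, Subtype.ext (Unitary.coe_star_mul_self _),
    Subtype.ext (Unitary.coe_mul_star_self _)⟩, StarAlgEquiv.ext fun _ => rfl⟩

end DirectSum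

section Local

theorem starSubalgebra_le_centralizer_iff {R A : Type*} [CommSemiring R] [StarRing R] [Semiring A]
    [StarRing A] [Algebra R A] [StarModule R A] {S T : StarSubalgebra R A} :
    S ≤ StarSubalgebra.centralizer R (T : Set A) ↔ ∀ a ∈ S, ∀ b ∈ T, Commute a b := by
  simp only [SetLike.le_def, StarSubalgebra.mem_centralizer_iff, SetLike.mem_coe]
  exact forall₂_congr fun a _ => ⟨fun h b hb => (h b hb).1.symm,
    fun h b hb => ⟨(h b hb).eq.symm, (h _ (star_mem hb)).eq.symm⟩⟩

/-- The algebra `⨂_{l ∈ t} M_{nₗ}` generated by finitely many of the tensor factors. -/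
noncomputable def localSubalgebra (n : ℕ → ℕ) [∀ l, NeZero (n l)] (t : Finset ℕ) :
    StarSubalgebra ℂ (Hilb n →L[ℂ] Hilb n) :=
  ⨆ l ∈ t, (factorHom n l).range

theorem factorHom_mem_localSubalgebra {t : Finset ℕ} {l : ℕ} (hl : l ∈ t)
    (a : Matrix (ZMod (n l)) (ZMod (n l)) ℂ) : factorHom n l a ∈ localSubalgebra n t :=
  le_iSup₂ (f := fun l (_ : l ∈ t) => (factorHom n l).range) l hl ⟨a, rfl⟩

theorem localSubalgebra_mono : Monotone (localSubalgebra n) :=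
  fun _ _ h => biSup_mono fun _ hl => h hl

theorem localSubalgebra_le_uhfSubalgebra (t : Finset ℕ) : localSubalgebra n t ≤ uhfSubalgebra n :=
  (iSup₂_le_iSup _ _).trans (StarSubalgebra.le_topologicalClosure _)

theorem commute_of_mem_localSubalgebra {s t : Finset ℕ} (hst : Disjoint s t)
    {a b : Hilb n →L[ℂ] Hilb n} (ha : a ∈ localSubalgebra n s) (hb : b ∈ localSubalgebra n t) :
    Commute a b := by
  suffices h : localSubalgebra n s ≤ StarSubalgebra.centralizer ℂ (localSubalgebra n t : Set _) from
    starSubalgebra_le_centralizer_iff.1 h a ha b hb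
  refine iSup₂_le fun l hl => starSubalgebra_le_centralizer_iff.2 fun x hx y hy => ?_
  have hle : localSubalgebra n t ≤
      StarSubalgebra.centralizer ℂ ((factorHom n l).range : Set _) := by
    refine iSup₂_le fun m hm => starSubalgebra_le_centralizer_iff.2 ?_
    have hml : m ≠ l := by
      rintro rfl
      exact Finset.disjoint_left.1 hst hl hm
    rintro _ ⟨c, rfl⟩ _ ⟨d, rfl⟩
    exact factorHom_commute hml c d
  exact (starSubalgebra_le_centralizer_iff.1 hle y hy x hx).symm

theorem dense_setOf_mem_localSubalgebra :
    Dense {x : UHF n | ∃ t, (x : Hilb n →L[ℂ] Hilb n) ∈ localSubalgebra n t} := by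
  have hunion : ((⨆ l, (factorHom n l).range : StarSubalgebra ℂ (Hilb n →L[ℂ] Hilb n)) :
      Set (Hilb n →L[ℂ] Hilb n)) = ⋃ t, localSubalgebra n t := by
    rw [iSup_eq_iSup_finset]
    exact StarSubalgebra.coe_iSup_of_directed localSubalgebra_mono.directed_le
  rw [Subtype.dense_iff]
  intro x hx
  have hx' : x ∈ closure (⋃ t, localSubalgebra n t : Set (Hilb n →L[ℂ] Hilb n)) := hunion ▸ hx
  refine closure_mono (fun y hy => ?_) hx'
  obtain ⟨t, ht⟩ := Set.mem_iUnion.1 hy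
  exact ⟨⟨y, localSubalgebra_le_uhfSubalgebra t ht⟩, ⟨t, ht⟩, rfl⟩

theorem exists_forall_mem_localSubalgebra {F : Finset (UHF n)}
    (hF : (F : Set (UHF n)) ⊆
      {x | ∃ t, (x : Hilb n →L[ℂ] Hilb n) ∈ localSubalgebra n t}) :
    ∃ t, ∀ a ∈ F, (a : Hilb n →L[ℂ] Hilb n) ∈ localSubalgebra n t := by
  choose! t ht using hF
  exact ⟨F.sup t, fun a ha => localSubalgebra_mono (Finset.le_sup ha) (ht ha)⟩

end Local

section Cylinder

theorem multiplicationAlong_eval (l : ℕ) (f : ZMod (n l) → ℂ) :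
    multiplicationAlong (fun x : CyclicProd n => x l) f = factorHom n l (Matrix.diagonal f) := by
  ext ξ x
  simp [factorHom_apply, Matrix.diagonal_apply]

theorem multiplicationAlong_restrict_mem_localSubalgebra (s : Finset ℕ)
    (f : (∀ l : s, ZMod (n l)) → ℂ) :
    multiplicationAlong (s.restrict : CyclicProd n → _) f ∈ localSubalgebra n s := by
  let M := multiplicationAlong (s.restrict : CyclicProd n → ∀ l : s, ZMod (n l))
  have hcoord (l : s) (h : ZMod (n l) → ℂ) :
      (fun v : ∀ l : s, ZMod (n l) => h (v l)) ∈ (localSubalgebra n s).comap M := by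
    change multiplicationAlong (fun x : CyclicProd n => x l) h ∈ localSubalgebra n s
    rw [multiplicationAlong_eval]
    exact factorHom_mem_localSubalgebra l.2 _
  have hpoint (v : ∀ l : s, ZMod (n l)) : Pi.single v (1 : ℂ)
      = ∏ l : s, fun w : ∀ l : s, ZMod (n l) => (Pi.single (v l) 1 : ZMod (n l) → ℂ) (w l) := by
    ext w
    simp [Finset.prod_apply, Pi.single_apply, Finset.prod_ite_zero, funext_iff]
  have hf : f = ∑ v, f v • Pi.single v (1 : ℂ) := by
    simp only [← Pi.single_smul, smul_eq_mul, mul_one, Finset.univ_sum_single]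
  rw [hf]
  refine sum_mem (S := (localSubalgebra n s).comap M) fun v _ => SMulMemClass.smul_mem _ ?_
  rw [hpoint]
  exact prod_mem fun l _ => hcoord l _

/-- Multiplication by a function of the coordinates in a finite set `s`, as an element of the UHF
algebra. -/
noncomputable def cylinder (n : ℕ → ℕ) [∀ l, NeZero (n l)] (s : Finset ℕ) :
    ((∀ l : s, ZMod (n l)) → ℂ) →⋆ₐ[ℂ] UHF n :=
  (multiplicationAlong s.restrict).codRestrict (uhfSubalgebra n) fun f =>
    localSubalgebra_le_uhfSubalgebra s (multiplicationAlong_restrict_mem_localSubalgebra s f)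

theorem prodAction_cylinder (g : CyclicProd n) (s : Finset ℕ) (f : (∀ l : s, ZMod (n l)) → ℂ) :
    prodAction n (Multiplicative.ofAdd g) (cylinder n s f)
      = cylinder n s fun v => f (v - s.restrict g) := by
  refine Subtype.ext ?_
  ext ξ x
  change (Unitary.conjStarAlgAut ℂ _ (translation n (Multiplicative.ofAdd g))
    (multiplicationAlong s.restrict f)) ξ x = f (s.restrict (x - g)) * ξ x
  simp only [Unitary.conjStarAlgAut_apply, mul_apply_eq_comp, translation_apply,
    multiplicationAlong_apply, star_translation_apply, sub_add_cancel]

theorem isProjectionPartition_cylinder {K : Type*} [Fintype K] [DecidableEq K] (s : Finset ℕ)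
    (c : (∀ l : s, ZMod (n l)) → K) :
    IsProjectionPartition (fun k => cylinder n s fun v => if c v = k then 1 else 0) 1 := by
  simpa only [map_one] using (isProjectionPartition_ite_eq c).map (cylinder n s)

theorem commute_cylinder {s t : Finset ℕ} (hst : Disjoint s t) {a : UHF n}
    (ha : (a : Hilb n →L[ℂ] Hilb n) ∈ localSubalgebra n t) (f : (∀ l : s, ZMod (n l)) → ℂ) :
    Commute a (cylinder n s f) :=
  Subtype.ext (commute_of_mem_localSubalgebra hst.symm ha
    (multiplicationAlong_restrict_mem_localSubalgebra s f)).eq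

end Cylinder

section RokhlinAction

theorem isUniformlyOuter_prodAction {g : CyclicProd n} (hg : g ∉ cyclicSum n) :
    IsUniformlyOuter (prodAction n (Multiplicative.ofAdd g)) := by
  refine isUniformlyOuter_of_dense dense_setOf_mem_localSubalgebra fun F hF => ?_
  obtain ⟨t, ht⟩ := exists_forall_mem_localSubalgebra hF
  have hinf : {l | g l ≠ 0}.Infinite := hg
  obtain ⟨l, hgl, hlt⟩ := hinf.exists_notMem_finset t
  let c := Fintype.equivFin (∀ m : ({l} : Finset ℕ), ZMod (n m))
  refine ⟨_, _, isProjectionPartition_cylinder {l} c, fun i => ?_,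
    fun i a ha => commute_cylinder (Finset.disjoint_singleton_left.2 hlt) (ht a ha) _⟩
  have hmove (v) : v - Finset.restrict {l} g ≠ v := fun h =>
    hgl (congrFun (sub_eq_self.1 h) ⟨l, Finset.mem_singleton_self l⟩)
  rw [prodAction_cylinder, ← map_mul, ← map_zero (cylinder n {l})]
  congr 1
  ext v
  by_cases hv : c v = i
  · have hv' : c (v - Finset.restrict {l} g) ≠ i := hv ▸ c.injective.ne (hmove v)
    simp [hv']
  · simp [hv]

theorem hasFiniteOrderRokhlin_prodAction {g : CyclicProd n} (hpos : 0 < addOrderOf g)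
    (hg : ∀ m : ℕ, m • g ∈ cyclicSum n → m • g = 0) :
    HasFiniteOrderRokhlin (addOrderOf g) (prodAction n (Multiplicative.ofAdd g)) := by
  refine hasFiniteOrderRokhlin_of_dense dense_setOf_mem_localSubalgebra fun F hF => ?_
  obtain ⟨t, ht⟩ := exists_forall_mem_localSubalgebra hF
  obtain ⟨s, hst, hs⟩ := exists_finset_disjoint_addOrderOf_restrict_eq hpos hg t
  obtain ⟨c, hc⟩ := exists_add_eq_finRotate (hs ▸ hpos)
  rw [← hs]
  refine ⟨_, isProjectionPartition_cylinder s c, fun i => ?_,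
    fun i a ha => commute_cylinder hst (ht a ha) _⟩
  rw [prodAction_cylinder]
  congr 1
  ext v
  have hcv : c v = finRotate _ (c (v - s.restrict g)) := by rw [← hc, sub_add_cancel]
  simp only [hcv, (finRotate _).injective.eq_iff]

end RokhlinAction

theorem mainTheorem1_general (n : ℕ → ℕ) [∀ l, NeZero (n l)] {G : Type*} [AddCommGroup G]
    (i : G →+ CyclicProd n) :
    HasRokhlinProperty (modelAction n i) ↔ (cyclicSum n).comap i = ⊥ := by
  refine ⟨fun h => (AddSubgroup.eq_bot_iff_forall _).2 fun g hg => ?_, fun h g => ?_⟩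
  · obtain ⟨u, hu⟩ := exists_prodAction_eq_conjStarAlgAut hg
    exact h.eq_zero_of_apply_eq_conjStarAlgAut hu
  have hzero {g : G} (hg : i g ∈ cyclicSum n) : g = 0 :=
    (AddSubgroup.eq_bot_iff_forall _).1 h g hg
  have hi : Function.Injective i :=
    (injective_iff_map_eq_zero i).2 fun g hg => hzero (hg ▸ zero_mem _)
  refine ⟨fun hpos => ?_, fun hinf j hj => ?_⟩
  · rw [← addOrderOf_injective i hi] at hpos ⊢
    refine hasFiniteOrderRokhlin_prodAction hpos fun m hm => ?_
    rw [← map_nsmul] at hm ⊢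
    rw [hzero hm, map_zero]
  · rw [← map_pow, ← ofAdd_nsmul]
    exact isUniformlyOuter_prodAction fun hmem =>
      (addOrderOf_eq_zero_iff'.1 hinf) j hj (hzero hmem)

end UHFModel

theorem mainTheorem1 (n : ℕ → ℕ) [∀ l, NeZero (n l)] (hn : UHFModel.IsUniversalType n)
    {G : Type*} [AddCommGroup G] (i : G →+ UHFModel.CyclicProd n)
    (hi : Function.Injective i) :
    UHFModel.HasRokhlinProperty (UHFModel.modelAction n i) ↔
      i.range ⊓ UHFModel.cyclicSum n = ⊥ := by
  rw [UHFModel.mainTheorem1_general, ← AddSubgroup.map_comap_eq,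
    AddSubgroup.map_eq_bot_iff_of_injective _ hi]
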